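/- Let $A\in\mathbb{R}^{n\times n}$, $B\in\mathbb{R}^{n\times m}$, $C\in\mathbb{R}^{p\times n}$, let $r\ge 0$ be an integer, let $\bar Q\in\mathbb{S}^m_+$ (the symmetric positive semidefinite $m\times m$ matrices) and $\rho\ge 0$, and put $\bar{\mathbb{P}}=\mathcal{N}(0,\bar Q)$. Let $$\mathcal{W}_2(\mu,\nu)=\inf_{\pi\in\Pi(\mu,\nu)}\Big(\int\|x-y\|^2\,d\pi(x,y)\Big)^{1/2}$$ be the 2-Wasserstein distance on $\mathbb{R}^m$, where $\Pi(\mu,\nu)$ is the set of couplings of $\mu$ and $\nu$, and for $\Gamma_1,\Gamma_2\in\mathbb{S}^m_+$ let $$G(\Gamma_1,\Gamma_2)=\sqrt{\operatorname{tr}\big(\Gamma_1+\Gamma_2-2(\Gamma_2^{1/2}\Gamma_1\Gamma_2^{1/2})^{1/2}\big)}$$ be the Gelbrich distance. Define the ambiguity sets $$\mathbb{W}_\rho(\bar{\mathbb{P}})=\{\mathbb{P}\ :\ \mathbb{P}\text{ a probability measure on }\mathbb{R}^m\text{ with finite second moment, } \mathbb{E}_{x\sim\mathbb{P}}[x]=0,\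 \mathcal{W}_2(\mathbb{P},\bar{\mathbb{P}})\le\rho\},$$ $$\mathbb{G}_\rho(\bar Q)=\{Q\in\mathbb{S}^m_+\ :\ G(Q,\bar Q)\le\rho\}.$$ A decision is a triple $(P,Z,\gamma)$ with $P\in\mathbb{R}^{(n+r)\times(n+r)}$, $Z\in\mathbb{R}^{n\times n}$, $\gamma\in\mathbb{R}$. For $Q\in\mathbb{S}^m_+$ let $\mathbb{B}(Q)$ be the set of decisions such that $\gamma\ge 0$, $Z\succeq 0$, $$P=\begin{bmatrix}P_1&P_2\\P_2^\top&P_3\end{bmatrix}\succ0,\quad P_1\in\mathbb{S}^n_+,\ P_3\in\mathbb{S}^r_+,\quad \begin{bmatrix}\Psi_1&\Psi_2\\\Psi_2^\top&\Psi_3\end{bmatrix}\prec0,\quad Z=P_2P_3^{-1}P_2^\top,\ \operatorname{rank}Z=r,\quad \operatorname{tr}\big(C(P_1-Z)C^\top\big)\le\gamma,$$ where $\Psi_1=AP_1A^\top-P_1+BQB^\top$ and $\Psi_2=\Psi_3=AZA^\top-P_1+BQB^\top$. For any family $\mathbb{F}=(\mathbb{F}(Q))_Q$ of sets of decisions, indexed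 by the $m\times m$ matrices $Q$, let $c_{\mathbb{F}}(P,Z,\gamma;Q)=\gamma$ if $(P,Z,\gamma)\in\mathbb{F}(Q)$ and $c_{\mathbb{F}}(P,Z,\gamma;Q)=+\infty$ otherwise, and define the optimal values in $[-\infty,+\infty]$ of the two Stackelberg games $$\gamma^\star_{\mathbb{F}}=\inf_{(P,Z,\gamma)}\ \sup_{\mathbb{P}\in\mathbb{W}_\rho(\bar{\mathbb{P}})}c_{\mathbb{F}}\big(P,Z,\gamma;\operatorname{Cov}(\mathbb{P})\big),\qquad \bar\gamma^\star_{\mathbb{F}}=\inf_{(P,Z,\gamma)}\ \sup_{Q\in\mathbb{G}_\rho(\bar Q)}c_{\mathbb{F}}(P,Z,\gamma;Q).$$ Then the game over the Wasserstein ambiguity set and the game over the Gelbrich ambiguity set with feasible sets $\mathbb{B}(Q)$ have the same optimal value, $\gamma^\star_{\mathbb{B}}=\bar\gamma^\star_{\mathbb{B}}$. Moreover, this does not depend on the form of the constraints: $\gamma^\star_{\mathbb{F}}=\bar\gamma^\star_{\mathbb{F}}$ for every family $\mathbb{F}$ of feasible sets. -/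

import Mathlib

noncomputable section

namespace DRMOR

open MeasureTheory ProbabilityTheory
open scoped Matrix MatrixOrder ENNReal

/-! ### Wasserstein distance and the Wasserstein ambiguity set -/

/-- The couplings of two measures on `ℝᵏ`: the probability measures on `ℝᵏ × ℝᵏ` whose two
marginals are `μ` and `ν`. -/
def couplings {k : ℕ} (μ ν : Measure (EuclideanSpace ℝ (Fin k))) :
    Set (Measure (EuclideanSpace ℝ (Fin k) × EuclideanSpace ℝ (Fin k))) :=
  {π | IsProbabilityMeasure π ∧ π.map Prod.fst = μ ∧ π.map Prod.snd = ν}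

/-- The 2-Wasserstein distance
`W₂(μ, ν) = inf_{π ∈ Π(μ, ν)} (∫ ‖x - y‖² dπ(x, y))^{1/2}`, with values in `[0, ∞]`
(it is finite when `μ` and `ν` are probability measures with finite second moments). -/
def wasserstein2 {k : ℕ} (μ ν : Measure (EuclideanSpace ℝ (Fin k))) : ℝ≥0∞ :=
  ⨅ π ∈ couplings μ ν, (∫⁻ z, ‖z.1 - z.2‖ₑ ^ 2 ∂π) ^ (1 / 2 : ℝ)

/-- The covariance matrix of a measure on `ℝᵏ`. -/
def covMatrix {k : ℕ} (P : Measure (EuclideanSpace ℝ (Fin k))) : Matrix (Fin k) (Fin k) ℝ :=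
  Matrix.of fun i j => cov[fun x => x i, fun x => x j; P]

/-- The Wasserstein ambiguity set of radius `ρ` around the nominal Gaussian `N(0, Qbar)`: all
probability measures with finite second moment and zero mean, at 2-Wasserstein distance at most
`ρ` from `N(0, Qbar)`. -/
def wassersteinBall {m : ℕ} (Qbar : Matrix (Fin m) (Fin m) ℝ) (ρ : ℝ) :
    Set (Measure (EuclideanSpace ℝ (Fin m))) :=
  {P | IsProbabilityMeasure P ∧ MemLp id 2 P ∧ ∫ x, x ∂P = 0 ∧
    wasserstein2 P (multivariateGaussian 0 Qbar) ≤ ENNReal.ofReal ρ}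

/-! ### Gelbrich distance and the Gelbrich ambiguity set -/

/-- The Gelbrich distance between two covariance matrices,
`G(Γ₁, Γ₂) = √ tr (Γ₁ + Γ₂ - 2 (Γ₂^{1/2} Γ₁ Γ₂^{1/2})^{1/2})`, where `CFC.sqrt` is the positive
semidefinite square root of a positive semidefinite matrix. -/
def gelbrich {m : ℕ} (Γ₁ Γ₂ : Matrix (Fin m) (Fin m) ℝ) : ℝ :=
  √(Γ₁ + Γ₂ - (2 : ℝ) • CFC.sqrt (CFC.sqrt Γ₂ * Γ₁ * CFC.sqrt Γ₂)).trace

/-- The Gelbrich ambiguity set: the positive semidefinite matrices (covariances of zero-mean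
inputs) at Gelbrich distance at most `ρ` from `Qbar`. -/
def gelbrichBall {m : ℕ} (Qbar : Matrix (Fin m) (Fin m) ℝ) (ρ : ℝ) :
    Set (Matrix (Fin m) (Fin m) ℝ) :=
  {Q | Q.PosSemidef ∧ gelbrich Q Qbar ≤ ρ}

/-! ### The decision variables and the feasible set of the model reduction problem -/

/-- The decision variables `(P_D, Z_D, γ)` of the designer. -/
structure Decision (n r : ℕ) where
  /-- The matrix `P_D`, with its `n + r` block structure. -/
  P : Matrix (Fin n ⊕ Fin r) (Fin n ⊕ Fin r) ℝ
  /-- The matrix `Z_D`. -/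
  Z : Matrix (Fin n) (Fin n) ℝ
  /-- The scalar bound `γ`. -/
  γ : ℝ

variable {n m p r : ℕ}

/-- The block `P₁` of `P_D`. -/
def Decision.P₁ (d : Decision n r) : Matrix (Fin n) (Fin n) ℝ := d.P.toBlocks₁₁

/-- The block `P₂` of `P_D`. -/
def Decision.P₂ (d : Decision n r) : Matrix (Fin n) (Fin r) ℝ := d.P.toBlocks₁₂

/-- The block `P₃` of `P_D`. -/
def Decision.P₃ (d : Decision n r) : Matrix (Fin r) (Fin r) ℝ := d.P.toBlocks₂₂

/-- The block matrix `Ψ(P_D, Z_D, Q)`. -/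
def Psi (A : Matrix (Fin n) (Fin n) ℝ) (B : Matrix (Fin n) (Fin m) ℝ) (d : Decision n r)
    (Q : Matrix (Fin m) (Fin m) ℝ) : Matrix (Fin n ⊕ Fin n) (Fin n ⊕ Fin n) ℝ :=
  let Ψ₁ := A * d.P₁ * Aᵀ - d.P₁ + B * Q * Bᵀ
  let Ψ₂ := A * d.Z * Aᵀ - d.P₁ + B * Q * Bᵀ
  let Ψ₃ := A * d.Z * Aᵀ - d.P₁ + B * Q * Bᵀ
  Matrix.fromBlocks Ψ₁ Ψ₂ Ψ₂ᵀ Ψ₃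

/-- The solution set `𝔹(Q)` of the model reduction problem for the system `(A, B, C)` with input
covariance `Q`. -/
def feasibleSet (A : Matrix (Fin n) (Fin n) ℝ) (B : Matrix (Fin n) (Fin m) ℝ)
    (C : Matrix (Fin p) (Fin n) ℝ) (r : ℕ) (Q : Matrix (Fin m) (Fin m) ℝ) :
    Set (Decision n r) :=
  {d | 0 ≤ d.γ ∧ d.Z.PosSemidef ∧
    d.P = Matrix.fromBlocks d.P₁ d.P₂ d.P₂ᵀ d.P₃ ∧ d.P.PosDef ∧
    d.P₁.PosSemidef ∧ d.P₃.PosSemidef ∧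
    (-Psi A B d Q).PosDef ∧
    d.Z = d.P₂ * d.P₃⁻¹ * d.P₂ᵀ ∧ d.Z.rank = r ∧
    (C * (d.P₁ - d.Z) * Cᵀ).trace ≤ d.γ}

/-! ### The two Stackelberg games

The leader chooses `d = (P_D, Z_D, γ)`, then the follower chooses the input law (or its
covariance). The cost is `γ` if `d` belongs to the set of feasible decisions for the follower's
covariance `Q`, and `+∞` otherwise. Optimal values are taken in `[-∞, +∞]`, with `inf` and `sup`
for `min` and `max`. -/

open Classical in
/-- The cost of the decision `d` if `S` is the set of feasible decisions. -/
def cost (S : Set (Decision n r)) (d : Decision n r) : EReal :=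
  if d ∈ S then (d.γ : EReal) else ⊤

/-- The optimal value of the Stackelberg game over the Wasserstein ambiguity set, with feasible
sets `F Q`. -/
def wassersteinValue (F : Matrix (Fin m) (Fin m) ℝ → Set (Decision n r))
    (Qbar : Matrix (Fin m) (Fin m) ℝ) (ρ : ℝ) : EReal :=
  ⨅ d : Decision n r, ⨆ P ∈ wassersteinBall Qbar ρ, cost (F (covMatrix P)) d

/-- The optimal value of the Stackelberg game over the Gelbrich ambiguity set, with feasible
sets `F Q`. -/
def gelbrichValue (F : Matrix (Fin m) (Fin m) ℝ → Set (Decision n r))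
    (Qbar : Matrix (Fin m) (Fin m) ℝ) (ρ : ℝ) : EReal :=
  ⨅ d : Decision n r, ⨆ Q ∈ gelbrichBall Qbar ρ, cost (F Q) d

end DRMOR

end

/-! The cost sees a measure only through its covariance, so it suffices that `covMatrix` maps the
Wasserstein ball onto the Gelbrich ball (`image_covMatrix_wassersteinBall`); the inner suprema then
agree for each decision, whatever `F` is. Into: for any coupling and any `S ≻ 0`, integrate `2 x·y ≤
x·Sx + y·S⁻¹y` and optimise over `S` (`le_two_mul_trace_sqrt`); this gives the Gelbrich bound
`gelbrich_le_wasserstein2`. Onto: `Q` is the covariance of `N(0, Q)`, and jointly Gaussian couplings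
of `N(0, Q)` with the nominal law have cost arbitrarily close to the squared Gelbrich distance
(`exists_jointCovariance`, `wasserstein2_multivariateGaussian_le`). Both optimisers involve inverses
of possibly singular matrices, hence the shifts by `ε • 1` and the limits. -/

noncomputable section

namespace DRMOR

open MeasureTheory ProbabilityTheory
open scoped Matrix MatrixOrder ENNReal
open Filter Topology

/-! ### Matrix optimisation behind the Gelbrich distance -/

section MatrixFacts

variable {ι : Type*} [Fintype ι] [DecidableEq ι]

lemma posSemidef_sqrt (M : Matrix ι ι ℝ) : (CFC.sqrt M).PosSemidef :=
  Matrix.nonneg_iff_posSemidef.1 (CFC.sqrt_nonneg M)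

omit [Fintype ι] [DecidableEq ι] in
lemma transpose_eq_self_of_posSemidef {M : Matrix ι ι ℝ} (hM : M.PosSemidef) : Mᵀ = M := by
  simpa using hM.isHermitian.eq

lemma sqrt_mul_sqrt {M : Matrix ι ι ℝ} (hM : M.PosSemidef) : CFC.sqrt M * CFC.sqrt M = M :=
  CFC.sqrt_mul_sqrt_self _ hM.nonneg

omit [DecidableEq ι] in
lemma posSemidef_mul_mul_self {M N : Matrix ι ι ℝ} (hM : M.PosSemidef) (hN : N.PosSemidef) :
    (M * N * M).PosSemidef := by
  have := hN.mul_mul_conjTranspose_same M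
  rwa [hM.isHermitian.eq] at this

lemma trace_mul_nonneg {M N : Matrix ι ι ℝ} (hM : M.PosSemidef) (hN : N.PosSemidef) :
    0 ≤ (M * N).trace := by
  rw [← sqrt_mul_sqrt hN, ← Matrix.mul_assoc, Matrix.trace_mul_comm, ← Matrix.mul_assoc]
  exact (posSemidef_mul_mul_self (posSemidef_sqrt N) hM).trace_nonneg

omit [Fintype ι] in
lemma posDef_add_smul_one {M : Matrix ι ι ℝ} (hM : M.PosSemidef) {ε : ℝ} (hε : 0 < ε) :
    (M + ε • (1 : Matrix ι ι ℝ)).PosDef :=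
  Matrix.PosDef.posSemidef_add hM (Matrix.PosDef.one.smul hε)

/-- A substitute for `M⁻¹` when `M` may be singular. -/
lemma exists_resolvent {M : Matrix ι ι ℝ} (hM : M.PosSemidef) {ε : ℝ} (hε : 0 < ε) :
    ∃ X : Matrix ι ι ℝ, X.PosSemidef ∧ X * (M + ε • (1 : Matrix ι ι ℝ)) = 1 ∧
      (M + ε • (1 : Matrix ι ι ℝ)) * X = 1 := by
  have h := posDef_add_smul_one hM hε
  have hu := (Matrix.isUnit_iff_isUnit_det _).1 h.isUnit
  exact ⟨_, h.inv.posSemidef, Matrix.nonsing_inv_mul _ hu, Matrix.mul_nonsing_inv _ hu⟩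

/-- The minimum of `tr (S Q) + tr (S⁻¹ Q')` over positive semidefinite invertible `S` is at most
the trace term of the Gelbrich distance. -/
lemma le_two_mul_trace_sqrt {Q Q' : Matrix ι ι ℝ} (hQ : Q.PosSemidef) (hQ' : Q'.PosSemidef) {c : ℝ}
    (h : ∀ S V : Matrix ι ι ℝ, S.PosSemidef → V.PosSemidef → S * V = 1 →
      c ≤ (S * Q).trace + (V * Q').trace) :
    c ≤ 2 * (CFC.sqrt (CFC.sqrt Q' * Q * CFC.sqrt Q')).trace := by
  set R := CFC.sqrt Q' with hRdef
  have hR : R.PosSemidef := posSemidef_sqrt _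
  have hRR : R * R = Q' := sqrt_mul_sqrt hQ'
  set T := CFC.sqrt (R * Q * R) with hTdef
  have hT : T.PosSemidef := posSemidef_sqrt _
  have hTT : T * T = R * Q * R := sqrt_mul_sqrt (posSemidef_mul_mul_self hR hQ)
  have key : ∀ δ : ℝ, 0 < δ → c ≤ 2 * T.trace + δ * (Fintype.card ι : ℝ) := by
    intro δ hδ
    obtain ⟨X, hX, hXl, hXr⟩ := exists_resolvent hT hδ
    have hTδ : (T + δ • (1 : Matrix ι ι ℝ)).PosSemidef := (posDef_add_smul_one hT hδ).posSemidef
    have step : ∀ ε : ℝ, 0 < ε →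
        c ≤ (X * (R + ε • (1 : Matrix ι ι ℝ)) * Q * (R + ε • (1 : Matrix ι ι ℝ))).trace
          + (T + δ • (1 : Matrix ι ι ℝ)).trace := by
      intro ε hε
      obtain ⟨Y, hY, hYl, hYr⟩ := exists_resolvent hR hε
      have hRε : (R + ε • (1 : Matrix ι ι ℝ)).PosSemidef := (posDef_add_smul_one hR hε).posSemidef
      have hsq : (R + ε • (1 : Matrix ι ι ℝ)) * (R + ε • (1 : Matrix ι ι ℝ))
          = Q' + ((2 * ε) • R + (ε * ε) • (1 : Matrix ι ι ℝ)) := by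
        rw [← hRR]; simp [mul_add, add_mul, smul_smul, two_mul, add_smul]; abel
      set G := R + ε • (1 : Matrix ι ι ℝ)
      set D := T + δ • (1 : Matrix ι ι ℝ)
      have hV : (Y * D * Y).PosSemidef := posSemidef_mul_mul_self hY hTδ
      -- Formally the minimiser is `S = R T⁻¹ R`, with inverse `R⁻¹ T R⁻¹`; here `R` and `T` are
      -- replaced by the invertible `G` and `D`. Since `G * G` dominates `Q'`, the second trace is
      -- at most `tr D`.
      have h1 := h (G * X * G) (Y * D * Y) (posSemidef_mul_mul_self hRε hX) hV (by
        calc G * X * G * (Y * D * Y) = G * (X * (G * Y) * D) * Y := by simp only [Matrix.mul_assoc]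
          _ = 1 := by rw [hYr, Matrix.mul_one, hXl, Matrix.mul_one, hYr])
      have h2 : (Y * D * Y * (G * G)).trace = D.trace := by
        calc (Y * D * Y * (G * G)).trace = ((Y * D) * (Y * G) * G).trace := by
              simp only [Matrix.mul_assoc]
          _ = D.trace := by
              rw [hYl, Matrix.mul_one, Matrix.trace_mul_comm, ← Matrix.mul_assoc, hYr,
                Matrix.one_mul]
      have h3 : 0 ≤ (Y * D * Y * ((2 * ε) • R + (ε * ε) • (1 : Matrix ι ι ℝ))).trace :=
        trace_mul_nonneg hV ((hR.smul (by positivity)).add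
          (Matrix.PosSemidef.one.smul (by positivity)))
      rw [hsq, Matrix.mul_add, Matrix.trace_add] at h2
      have h4 : (G * X * G * Q).trace = (X * G * Q * G).trace := by
        rw [Matrix.mul_assoc, Matrix.mul_assoc, Matrix.trace_mul_comm]
        simp only [Matrix.mul_assoc]
      linarith
    -- `X` depends on `δ` only, so `ε → 0` can be taken first with `δ` fixed.
    have hlim : Tendsto (fun ε : ℝ =>
        (X * (R + ε • (1 : Matrix ι ι ℝ)) * Q * (R + ε • (1 : Matrix ι ι ℝ))).trace
          + (T + δ • (1 : Matrix ι ι ℝ)).trace) (𝓝[>] 0)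
        (𝓝 ((X * (R + (0 : ℝ) • (1 : Matrix ι ι ℝ)) * Q *
          (R + (0 : ℝ) • (1 : Matrix ι ι ℝ))).trace
          + (T + δ • (1 : Matrix ι ι ℝ)).trace)) := by
      have : Continuous (fun ε : ℝ =>
        (X * (R + ε • (1 : Matrix ι ι ℝ)) * Q * (R + ε • (1 : Matrix ι ι ℝ))).trace
          + (T + δ • (1 : Matrix ι ι ℝ)).trace) := by fun_prop
      exact (this.tendsto 0).mono_left nhdsWithin_le_nhds
    have h5 := ge_of_tendsto hlim (eventually_mem_nhdsWithin.mono fun ε hε => step ε hε)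
    have h6 : (X * T * T).trace ≤ T.trace := by
      have h7 : X * T + δ • X = 1 := by rw [← hXl, Matrix.mul_add]; simp
      have h8 : T = X * T * T + δ • (X * T) := by
        calc T = (X * T + δ • X) * T := by rw [h7, Matrix.one_mul]
          _ = _ := by rw [Matrix.add_mul, Matrix.smul_mul]
      have h9 := congrArg Matrix.trace h8
      rw [Matrix.trace_add, Matrix.trace_smul, smul_eq_mul] at h9
      nlinarith [trace_mul_nonneg hX hT]
    have h10 : X * R * Q * R = X * T * T := by
      rw [Matrix.mul_assoc X T, hTT]; simp only [Matrix.mul_assoc]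
    simp only [zero_smul, add_zero, h10, Matrix.trace_add, Matrix.trace_smul, Matrix.trace_one,
      smul_eq_mul] at h5
    linarith
  have hlim : Tendsto (fun δ : ℝ => 2 * T.trace + δ * (Fintype.card ι : ℝ)) (𝓝[>] 0)
      (𝓝 (2 * T.trace + 0 * (Fintype.card ι : ℝ))) := by
    have : Continuous (fun δ : ℝ => 2 * T.trace + δ * (Fintype.card ι : ℝ)) := by fun_prop
    exact (this.tendsto 0).mono_left nhdsWithin_le_nhds
  have := ge_of_tendsto hlim (eventually_mem_nhdsWithin.mono fun ε hε => key ε hε)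
  simpa using this

/-- A joint covariance with marginals `Q` and `Q'` whose cross-covariance has almost the largest
possible trace. -/
lemma exists_jointCovariance {Q Q' : Matrix ι ι ℝ} (hQ : Q.PosSemidef) (hQ' : Q'.PosSemidef) {ε : ℝ}
    (hε : 0 < ε) :
    ∃ K : Matrix ι ι ℝ, (Matrix.fromBlocks Q K Kᵀ Q').PosSemidef ∧
      (CFC.sqrt (CFC.sqrt Q' * Q * CFC.sqrt Q')).trace - ε * (Fintype.card ι : ℝ) ≤ K.trace := by
  set R := CFC.sqrt Q' with hRdef
  have hR : R.PosSemidef := posSemidef_sqrt _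
  have hRR : R * R = Q' := sqrt_mul_sqrt hQ'
  set U := CFC.sqrt Q with hUdef
  have hU : U.PosSemidef := posSemidef_sqrt _
  have hUU : U * U = Q := sqrt_mul_sqrt hQ
  set T := CFC.sqrt (R * Q * R) with hTdef
  have hT : T.PosSemidef := posSemidef_sqrt _
  have hTT : T * T = R * Q * R := sqrt_mul_sqrt (posSemidef_mul_mul_self hR hQ)
  obtain ⟨X, hX, hXl, hXr⟩ := exists_resolvent hT hε
  have hsq : (T + ε • (1 : Matrix ι ι ℝ)) * (T + ε • (1 : Matrix ι ι ℝ))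
      = T * T + ((2 * ε) • T + (ε * ε) • (1 : Matrix ι ι ℝ)) := by
    simp [mul_add, add_mul, smul_smul, two_mul, add_smul]; abel
  set E := (2 * ε) • T + (ε * ε) • (1 : Matrix ι ι ℝ) with hE
  have hEpos : E.PosSemidef := (hT.smul (by positivity)).add
    (Matrix.PosSemidef.one.smul (by positivity))
  have tR := transpose_eq_self_of_posSemidef hR
  have tU := transpose_eq_self_of_posSemidef hU
  have tX := transpose_eq_self_of_posSemidef hX
  have hone : X * (R * Q * R) * X + X * E * X = 1 := by
    rw [← Matrix.add_mul, ← Matrix.mul_add, ← hTT, ← hsq, ← Matrix.mul_assoc, hXl, Matrix.one_mul,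
      hXr]
  -- The optimal map is formally `x ↦ R T⁻¹ R x`, with cross-covariance `Q R T⁻¹ R`; `X` replaces
  -- `T⁻¹`. Adding to `R X R x` an independent noise of covariance `R X E X R` restores the second
  -- marginal `Q'`, by `hone`. The sum `N * Nᴴ + M * E * Mᴴ` below is the covariance of this pair.
  refine ⟨Q * R * X * R, ?_, ?_⟩
  · let N : Matrix (ι ⊕ ι) ι ℝ := Matrix.fromRows U (R * X * R * U)
    let M : Matrix (ι ⊕ ι) ι ℝ := Matrix.fromRows 0 (R * X)
    have hsum : Matrix.fromBlocks Q (Q * R * X * R) (Q * R * X * R)ᵀ Q'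
        = N * Nᴴ + M * E * Mᴴ := by
      rw [Matrix.conjTranspose_eq_transpose_of_trivial, Matrix.conjTranspose_eq_transpose_of_trivial,
        Matrix.transpose_fromRows, Matrix.transpose_fromRows, Matrix.fromRows_mul_fromCols,
        Matrix.fromRows_mul 0 (R * X) E, Matrix.fromRows_mul_fromCols, Matrix.fromBlocks_add]
      simp only [Matrix.transpose_mul, tR, tU, tX, transpose_eq_self_of_posSemidef hQ]
      congr 1
      · simp [hUU]
      · simp [← hUU, Matrix.mul_assoc]
      · simp [← hUU, Matrix.mul_assoc]
      · calc Q' = R * (X * (R * Q * R) * X + X * E * X) * R := by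
              rw [hone, Matrix.mul_one, hRR]
          _ = _ := by simp only [← hUU, Matrix.mul_assoc, Matrix.mul_add, Matrix.add_mul]
    rw [hsum]
    exact (Matrix.posSemidef_self_mul_conjTranspose N).add (hEpos.mul_mul_conjTranspose_same M)
  · have h1 : (Q * R * X * R).trace = (T * T * X).trace := by
      rw [Matrix.trace_mul_comm, hTT]; simp only [Matrix.mul_assoc]
    have h2 : T * X = 1 - ε • X := by
      rw [eq_sub_iff_add_eq, ← hXr, Matrix.add_mul]; simp
    have h3 : T * T * X = T - ε • (1 : Matrix ι ι ℝ) + (ε * ε) • X := by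
      rw [Matrix.mul_assoc, h2, Matrix.mul_sub, Matrix.mul_smul, h2, smul_sub, smul_smul]; simp
      abel
    rw [h1, h3]
    simp only [Matrix.trace_add, Matrix.trace_sub, Matrix.trace_smul, Matrix.trace_one, smul_eq_mul]
    have := hX.trace_nonneg
    nlinarith [mul_nonneg (mul_pos hε hε).le this]

end MatrixFacts
-- Second moments and quadratic forms
section Moments

variable {ι κ : Type*} [Fintype ι] [Fintype κ]

lemma memLp_eval {P : Measure (EuclideanSpace ℝ ι)} (hP : MemLp id 2 P) (i : ι) :
    MemLp (fun x : EuclideanSpace ℝ ι => x i) 2 P :=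
  (EuclideanSpace.proj i : EuclideanSpace ℝ ι →L[ℝ] ℝ).comp_memLp' hP

lemma integral_eval_eq_zero {P : Measure (EuclideanSpace ℝ ι)} [IsProbabilityMeasure P]
    (hP : MemLp id 2 P) (hmean : ∫ x, x ∂P = 0) (i : ι) :
    ∫ x, x i ∂P = 0 := by
  have h := (EuclideanSpace.proj i : EuclideanSpace ℝ ι →L[ℝ] ℝ).integral_comp_comm
    (hP.integrable one_le_two)
  simpa [hmean] using h

lemma integral_eval_mul_eval {P : Measure (EuclideanSpace ℝ ι)} [IsProbabilityMeasure P]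
    (hP : MemLp id 2 P) (hmean : ∫ x, x ∂P = 0) (i j : ι) :
    ∫ x, x i * x j ∂P = cov[fun x => x i, fun x => x j; P] := by
  rw [covariance_eq_sub (memLp_eval hP i) (memLp_eval hP j), integral_eval_eq_zero hP hmean i]
  simp

lemma integrable_eval_mul_eval {P : Measure (EuclideanSpace ℝ ι)} (hP : MemLp id 2 P) (i j : ι) :
    Integrable (fun x : EuclideanSpace ℝ ι => x i * x j) P :=
  (memLp_eval hP i).integrable_mul (memLp_eval hP j)

lemma dotProduct_mulVec_eq_sum (M : Matrix ι ι ℝ) (x : ι → ℝ) :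
    x ⬝ᵥ M *ᵥ x = ∑ i, ∑ j, M i j * (x i * x j) := by
  simp only [dotProduct, Matrix.mulVec, Finset.mul_sum]
  exact Finset.sum_congr rfl fun i _ => Finset.sum_congr rfl fun j _ => by ring

lemma integrable_quadForm {P : Measure (EuclideanSpace ℝ ι)} (hP : MemLp id 2 P)
    (M : Matrix ι ι ℝ) :
    Integrable (fun x : EuclideanSpace ℝ ι => x.ofLp ⬝ᵥ M *ᵥ x.ofLp) P := by
  simp only [dotProduct_mulVec_eq_sum]
  exact integrable_finsetSum _ fun i _ => integrable_finsetSum _ fun j _ =>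
    (integrable_eval_mul_eval hP i j).const_mul _

/-- For centred laws covariances are second moments. `S` is a parameter because `covMatrix` covers
only `Fin k`, while the Gaussian coupling lives on `Fin k ⊕ Fin k`. -/
lemma integral_quadForm {P : Measure (EuclideanSpace ℝ ι)} [IsProbabilityMeasure P]
    (hP : MemLp id 2 P) (hmean : ∫ x, x ∂P = 0) {S : Matrix ι ι ℝ}
    (hS : ∀ i j, cov[fun x => x i, fun x => x j; P] = S i j) (M : Matrix ι ι ℝ) :
    ∫ x, x.ofLp ⬝ᵥ M *ᵥ x.ofLp ∂P = (M * S).trace := by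
  simp only [dotProduct_mulVec_eq_sum]
  rw [integral_finsetSum _ fun i _ => integrable_finsetSum _ fun j _ =>
    (integrable_eval_mul_eval hP i j).const_mul (M i j)]
  simp only [Matrix.trace, Matrix.diag, Matrix.mul_apply]
  refine Finset.sum_congr rfl fun i _ => ?_
  rw [integral_finsetSum _ fun j _ => (integrable_eval_mul_eval hP i j).const_mul (M i j)]
  refine Finset.sum_congr rfl fun j _ => ?_
  rw [integral_const_mul, integral_eval_mul_eval hP hmean, covariance_comm, hS]

/-- The quadratic form at `v` is `∫ (v·x)²`, obtained by taking `M = v vᵀ` in `integral_quadForm`.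
-/
lemma posSemidef_covMatrix {k : ℕ} {P : Measure (EuclideanSpace ℝ (Fin k))}
    [IsProbabilityMeasure P] (hP : MemLp id 2 P) (hmean : ∫ x, x ∂P = 0) :
    (covMatrix P).PosSemidef := by
  refine Matrix.PosSemidef.of_dotProduct_mulVec_nonneg ?_ fun v => ?_
  · ext i j
    simp [covMatrix, covariance_comm]
  · have h := integral_quadForm hP hmean (S := covMatrix P) (fun _ _ => rfl)
      (Matrix.vecMulVec v v)
    rw [Matrix.vecMulVec_mul, Matrix.trace_vecMulVec, dotProduct_comm,
      ← Matrix.dotProduct_mulVec] at h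
    simp only [star_trivial]
    rw [← h]
    refine integral_nonneg fun x => ?_
    simp only [Matrix.vecMulVec_mulVec, Pi.zero_apply, dotProduct_smul]
    rw [dotProduct_comm, op_smul_eq_smul, smul_eq_mul]
    exact mul_self_nonneg _

lemma norm_sq_eq_dotProduct (x : EuclideanSpace ℝ ι) : ‖x‖ ^ 2 = x.ofLp ⬝ᵥ x.ofLp := by
  rw [EuclideanSpace.real_norm_sq_eq]; simp [dotProduct, sq]

/-- Young's inequality for a pair of mutually inverse positive semidefinite matrices. -/
lemma two_mul_dotProduct_le [DecidableEq ι] {S V : Matrix ι ι ℝ} (hS : S.PosSemidef)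
    (hSV : S * V = 1) (x y : ι → ℝ) :
    2 * (x ⬝ᵥ y) ≤ x ⬝ᵥ S *ᵥ x + y ⬝ᵥ V *ᵥ y := by
  have h := hS.dotProduct_mulVec_nonneg (x - V *ᵥ y)
  have h1 : S *ᵥ V *ᵥ y = y := by rw [Matrix.mulVec_mulVec, hSV, Matrix.one_mulVec]
  have h2 : (V *ᵥ y) ⬝ᵥ (S *ᵥ x) = x ⬝ᵥ y := by
    rw [Matrix.dotProduct_mulVec, ← Matrix.mulVec_transpose, transpose_eq_self_of_posSemidef hS, h1,
      dotProduct_comm]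
  simp only [star_trivial, Matrix.mulVec_sub, h1, sub_dotProduct, dotProduct_sub, h2] at h
  rw [dotProduct_comm (V *ᵥ y) y] at h
  linarith

lemma lintegral_enorm_sub_sq {Ω : Type*} {mΩ : MeasurableSpace Ω} {π : Measure Ω}
    {X Y : Ω → EuclideanSpace ℝ ι} (hX : MemLp X 2 π) (hY : MemLp Y 2 π) :
    ∫⁻ z, ‖X z - Y z‖ₑ ^ 2 ∂π = ENNReal.ofReal (∫ z, ‖X z - Y z‖ ^ 2 ∂π) := by
  have hint : Integrable (fun z => ‖X z - Y z‖ ^ 2) π := (hX.sub hY).integrable_norm_pow two_ne_zero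
  rw [ofReal_integral_eq_lintegral_ofReal hint (ae_of_all _ fun z => by positivity)]
  refine lintegral_congr fun z => ?_
  rw [ENNReal.ofReal_pow (norm_nonneg _), ofReal_norm]

/-- Both sides truncate negative `a` to `0`, so the sign of the trace inside `gelbrich` never has to
be determined. -/
lemma ofReal_sqrt_eq_rpow (a : ℝ) :
    ENNReal.ofReal (√a) = ENNReal.ofReal a ^ (1 / 2 : ℝ) := by
  rcases le_total 0 a with h | h
  · rw [Real.sqrt_eq_rpow, ENNReal.ofReal_rpow_of_nonneg h (by norm_num)]
  · rw [Real.sqrt_eq_zero_of_nonpos h, ENNReal.ofReal_of_nonpos h]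
    simp

end Moments

/-! ### Lower bound on the Wasserstein distance -/

section GelbrichBound

variable {k : ℕ}

/-- The Gelbrich bound for centred measures. -/
theorem gelbrich_le_wasserstein2 {μ ν : Measure (EuclideanSpace ℝ (Fin k))}
    [IsProbabilityMeasure μ] [IsProbabilityMeasure ν] (hμ : MemLp id 2 μ) (hν : MemLp id 2 ν)
    (hμ0 : ∫ x, x ∂μ = 0) (hν0 : ∫ x, x ∂ν = 0) :
    ENNReal.ofReal (gelbrich (covMatrix μ) (covMatrix ν)) ≤ wasserstein2 μ ν := by
  refine le_iInf₂ fun π hπ => ?_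
  obtain ⟨hprob, rfl, rfl⟩ := hπ
  have hX : MemLp (fun z : EuclideanSpace ℝ (Fin k) × EuclideanSpace ℝ (Fin k) => z.1) 2 π :=
    hμ.comp_of_map measurable_fst.aemeasurable
  have hY : MemLp (fun z : EuclideanSpace ℝ (Fin k) × EuclideanSpace ℝ (Fin k) => z.2) 2 π :=
    hν.comp_of_map measurable_snd.aemeasurable
  rw [gelbrich, ofReal_sqrt_eq_rpow]
  refine ENNReal.rpow_le_rpow ?_ (by norm_num)
  rw [lintegral_enorm_sub_sq hX hY]
  refine ENNReal.ofReal_le_ofReal ?_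
  set Q := covMatrix (π.map Prod.fst) with hQ
  set Q' := covMatrix (π.map Prod.snd) with hQ'
  -- This `c` is `2 ∫ x·y dπ` written through the cost. Its hypothesis is Young's inequality in the
  -- form `x·(1 - S)x + y·(1 - V)y ≤ ‖x - y‖²`, integrated: the left side depends only on the
  -- marginals.
  have key := le_two_mul_trace_sqrt (posSemidef_covMatrix hμ hμ0) (posSemidef_covMatrix hν hν0)
    (c := Q.trace + Q'.trace - ∫ z, ‖z.1 - z.2‖ ^ 2 ∂π) fun S V hS _ hSV => by
      have e1 := integral_quadForm hμ hμ0 (S := Q) (fun _ _ => rfl) (1 - S)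
      have e2 := integral_quadForm hν hν0 (S := Q') (fun _ _ => rfl) (1 - V)
      have i1 := integrable_quadForm hμ (1 - S)
      have i2 := integrable_quadForm hν (1 - V)
      rw [integral_map measurable_fst.aemeasurable i1.aestronglyMeasurable] at e1
      rw [integral_map measurable_snd.aemeasurable i2.aestronglyMeasurable] at e2
      have j1 : Integrable (fun z => z.1.ofLp ⬝ᵥ (1 - S) *ᵥ z.1.ofLp) π :=
        i1.comp_measurable measurable_fst
      have j2 : Integrable (fun z => z.2.ofLp ⬝ᵥ (1 - V) *ᵥ z.2.ofLp) π :=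
        i2.comp_measurable measurable_snd
      have hle : ∫ z, (z.1.ofLp ⬝ᵥ (1 - S) *ᵥ z.1.ofLp + z.2.ofLp ⬝ᵥ (1 - V) *ᵥ z.2.ofLp) ∂π
          ≤ ∫ z, ‖z.1 - z.2‖ ^ 2 ∂π := by
        refine integral_mono (j1.add j2) ((hX.sub hY).integrable_norm_pow two_ne_zero) fun z => ?_
        have := two_mul_dotProduct_le hS hSV z.1.ofLp z.2.ofLp
        simp only [norm_sq_eq_dotProduct, Matrix.sub_mulVec, Matrix.one_mulVec, dotProduct_sub,
          WithLp.ofLp_sub, sub_dotProduct]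
        rw [dotProduct_comm z.2.ofLp z.1.ofLp]
        linarith
      rw [integral_add j1 j2, e1, e2] at hle
      simp only [Matrix.sub_mul, Matrix.one_mul, Matrix.trace_sub] at hle
      linarith
  simp only [Matrix.trace_sub, Matrix.trace_add, Matrix.trace_smul, smul_eq_mul]
  linarith

end GelbrichBound

/-! ### Gaussian couplings and equality of the two games -/

section GaussianCoupling

variable {ι κ : Type*} [Fintype ι] [Fintype κ] [DecidableEq ι] [DecidableEq κ]

/-- Pulling back the coordinates of a Euclidean vector along a map of index types. -/
def pullbackCLM (f : ι → κ) : EuclideanSpace ℝ κ →L[ℝ] EuclideanSpace ℝ ι :=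
  (EuclideanSpace.equiv ι ℝ).symm.toContinuousLinearMap ∘L
    ContinuousLinearMap.pi fun i => (EuclideanSpace.proj (f i) : EuclideanSpace ℝ κ →L[ℝ] ℝ)

omit [Fintype ι] [Fintype κ] [DecidableEq ι] [DecidableEq κ] in
@[simp]
lemma pullbackCLM_apply (f : ι → κ) (x : EuclideanSpace ℝ κ) (i : ι) :
    pullbackCLM f x i = x (f i) := rfl

/-- A Gaussian law is determined by its mean and covariance. With `f` equal to `Sum.inl` or
`Sum.inr` this gives the marginals of the coupling. -/
lemma multivariateGaussian_map_pullbackCLM {S : Matrix κ κ ℝ} (hS : S.PosSemidef) (f : ι → κ) :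
    (multivariateGaussian 0 S).map (pullbackCLM f) = multivariateGaussian 0 (S.submatrix f f) := by
  apply IsGaussian.ext
  · simp only [id_eq, integral_id_multivariateGaussian]
    rw [ContinuousLinearMap.integral_id_map, integral_id_multivariateGaussian, map_zero]
    exact IsGaussian.integrable_id
  rw [← ContinuousLinearMap.toBilinForm_inj]
  refine LinearMap.BilinForm.ext_basis (EuclideanSpace.basisFun ι ℝ).toBasis fun i j ↦ ?_
  rw [ContinuousLinearMap.toBilinForm_apply, ContinuousLinearMap.toBilinForm_apply,
    covarianceBilin_apply_eq_cov, covariance_map]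
  · have h (i : ι) : (fun u ↦ inner ℝ ((EuclideanSpace.basisFun ι ℝ).toBasis i) u) ∘
        pullbackCLM f = fun u ↦ u (f i) := by ext; simp [PiLp.inner_apply]
    simp_rw [h, covariance_eval_multivariateGaussian hS,
      covarianceBilin_multivariateGaussian (hS.submatrix _)]
    simp
  any_goals exact Measurable.aestronglyMeasurable (by fun_prop)
  · fun_prop
  · exact IsGaussian.memLp_two_id

theorem wasserstein2_multivariateGaussian_le {k : ℕ} {Q Q' : Matrix (Fin k) (Fin k) ℝ}
    (hQ : Q.PosSemidef) (hQ' : Q'.PosSemidef) :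
    wasserstein2 (multivariateGaussian 0 Q) (multivariateGaussian 0 Q')
      ≤ ENNReal.ofReal (gelbrich Q Q') := by
  set t := (CFC.sqrt (CFC.sqrt Q' * Q * CFC.sqrt Q')).trace
  have key : ∀ ε : ℝ, 0 < ε → wasserstein2 (multivariateGaussian 0 Q) (multivariateGaussian 0 Q')
      ≤ ENNReal.ofReal (√(Q.trace + Q'.trace - 2 * (t - ε * (Fintype.card (Fin k) : ℝ)))) := by
    intro ε hε
    obtain ⟨K, hS, hK⟩ := exists_jointCovariance hQ hQ' hε
    set S := Matrix.fromBlocks Q K Kᵀ Q'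
    set γ := multivariateGaussian (0 : EuclideanSpace ℝ (Fin k ⊕ Fin k)) S
    have hγ : MemLp id 2 γ := IsGaussian.memLp_two_id
    have hγ0 : ∫ x, x ∂γ = 0 := integral_id_multivariateGaussian
    let X := pullbackCLM (Sum.inl : Fin k → Fin k ⊕ Fin k)
    let Y := pullbackCLM (Sum.inr : Fin k → Fin k ⊕ Fin k)
    have hXY : Measurable fun x => (X x, Y x) := by fun_prop
    have hmem : γ.map (fun x => (X x, Y x)) ∈
        couplings (multivariateGaussian 0 Q) (multivariateGaussian 0 Q') := by
      refine ⟨Measure.isProbabilityMeasure_map hXY.aemeasurable, ?_, ?_⟩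
      · rw [Measure.map_map measurable_fst hXY]
        exact multivariateGaussian_map_pullbackCLM hS Sum.inl
      · rw [Measure.map_map measurable_snd hXY]
        exact multivariateGaussian_map_pullbackCLM hS Sum.inr
    refine (iInf₂_le _ hmem).trans ?_
    rw [ofReal_sqrt_eq_rpow]
    refine ENNReal.rpow_le_rpow ?_ (by norm_num)
    rw [lintegral_map (by fun_prop) hXY]
    refine (lintegral_enorm_sub_sq (X.comp_memLp' hγ) (Y.comp_memLp' hγ)).trans_le
      (ENNReal.ofReal_le_ofReal ?_)
    -- As a quadratic form in the joint vector, the cost is integrated by a trace against `S`.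
    have hquad : ∀ x : EuclideanSpace ℝ (Fin k ⊕ Fin k), ‖X x - Y x‖ ^ 2
        = x.ofLp ⬝ᵥ (Matrix.fromBlocks 1 (-1) (-1) 1 :
          Matrix (Fin k ⊕ Fin k) (Fin k ⊕ Fin k) ℝ) *ᵥ x.ofLp := by
      intro x
      rw [EuclideanSpace.real_norm_sq_eq, Matrix.fromBlocks_mulVec]
      simp only [dotProduct, Fintype.sum_sum_type, Sum.elim_inl, Sum.elim_inr, ← Finset.sum_add_distrib]
      refine Finset.sum_congr rfl fun i _ => ?_
      simp [X, Y, Matrix.neg_mulVec]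
      ring
    have hint : ∫ x, ‖X x - Y x‖ ^ 2 ∂γ = Q.trace + Q'.trace - 2 * K.trace := by
      simp only [hquad]
      rw [integral_quadForm hγ hγ0 (covariance_eval_multivariateGaussian hS),
        Matrix.fromBlocks_multiply]
      simp [Matrix.trace, Finset.sum_add_distrib]
      ring
    change ∫ x, ‖X x - Y x‖ ^ 2 ∂γ ≤ _
    rw [hint]
    linarith
  have hlim : Tendsto (fun ε : ℝ => ENNReal.ofReal
      (√(Q.trace + Q'.trace - 2 * (t - ε * (Fintype.card (Fin k) : ℝ))))) (𝓝[>] 0)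
      (𝓝 (ENNReal.ofReal
        (√(Q.trace + Q'.trace - 2 * (t - 0 * (Fintype.card (Fin k) : ℝ)))))) := by
    have : Continuous (fun ε : ℝ => ENNReal.ofReal
      (√(Q.trace + Q'.trace - 2 * (t - ε * (Fintype.card (Fin k) : ℝ))))) :=
      ENNReal.continuous_ofReal.comp (by fun_prop)
    exact (this.tendsto 0).mono_left nhdsWithin_le_nhds
  have h := ge_of_tendsto hlim (eventually_mem_nhdsWithin.mono fun ε hε => key ε hε)
  simpa [gelbrich, Matrix.trace_sub, Matrix.trace_add, Matrix.trace_smul] using h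

lemma covMatrix_multivariateGaussian {k : ℕ} {Q : Matrix (Fin k) (Fin k) ℝ} (hQ : Q.PosSemidef) :
    covMatrix (multivariateGaussian 0 Q) = Q := by
  ext i j
  exact covariance_eval_multivariateGaussian hQ i j

/-- The covariances of the measures in the Wasserstein ball are exactly the Gelbrich ball. -/
theorem image_covMatrix_wassersteinBall {m : ℕ} {Qbar : Matrix (Fin m) (Fin m) ℝ}
    (hQbar : Qbar.PosSemidef) {ρ : ℝ} (hρ : 0 ≤ ρ) :
    covMatrix '' wassersteinBall Qbar ρ = gelbrichBall Qbar ρ := by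
  ext Q
  constructor
  · rintro ⟨P, ⟨hprob, hP, hP0, hW⟩, rfl⟩
    refine ⟨posSemidef_covMatrix hP hP0, ?_⟩
    have h := (gelbrich_le_wasserstein2 hP IsGaussian.memLp_two_id hP0
      (integral_id_multivariateGaussian (S := Qbar))).trans hW
    -- For `ρ < 0` this would fail: `ENNReal.ofReal ρ = 0` still admits the nominal law, while the
    -- Gelbrich ball is empty.
    rwa [covMatrix_multivariateGaussian hQbar, ENNReal.ofReal_le_ofReal_iff hρ] at h
  · rintro ⟨hQ, hG⟩
    exact ⟨multivariateGaussian 0 Q, ⟨inferInstance, IsGaussian.memLp_two_id,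
      integral_id_multivariateGaussian,
      (wasserstein2_multivariateGaussian_le hQ hQbar).trans (ENNReal.ofReal_le_ofReal hG)⟩,
      covMatrix_multivariateGaussian hQ⟩

theorem wassersteinValue_eq_gelbrichValue {m n r : ℕ}
    (F : Matrix (Fin m) (Fin m) ℝ → Set (Decision n r)) {Qbar : Matrix (Fin m) (Fin m) ℝ}
    (hQbar : Qbar.PosSemidef) {ρ : ℝ} (hρ : 0 ≤ ρ) :
    wassersteinValue F Qbar ρ = gelbrichValue F Qbar ρ := by
  simp only [wassersteinValue, gelbrichValue, ← image_covMatrix_wassersteinBall hQbar hρ, iSup_image]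

end GaussianCoupling
end DRMOR

end

theorem theorem2 {n m p r : ℕ} (A : Matrix (Fin n) (Fin n) ℝ) (B : Matrix (Fin n) (Fin m) ℝ)
    (C : Matrix (Fin p) (Fin n) ℝ) (Qbar : Matrix (Fin m) (Fin m) ℝ) (hQbar : Qbar.PosSemidef)
    (ρ : ℝ) (hρ : 0 ≤ ρ) :
    DRMOR.wassersteinValue (DRMOR.feasibleSet A B C r) Qbar ρ
        = DRMOR.gelbrichValue (DRMOR.feasibleSet A B C r) Qbar ρ ∧
      ∀ F : Matrix (Fin m) (Fin m) ℝ → Set (DRMOR.Decision n r),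
        DRMOR.wassersteinValue F Qbar ρ = DRMOR.gelbrichValue F Qbar ρ := by
  exact ⟨DRMOR.wassersteinValue_eq_gelbrichValue _ hQbar hρ, fun F =>
    DRMOR.wassersteinValue_eq_gelbrichValue F hQbar hρ⟩
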